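/- Let $B$ be the open unit ball of $\mathbb C^2$ (Euclidean norm). For a compact set $X\subset\mathbb C^2$ let $$\widehat X=\{z\in\mathbb C^2: |p(z)|\le \max_{x\in X}|p(x)| \text{ for all polynomials } p\}$$ be its polynomial hull, and let $P(X)$ be the uniform closure in $C(X)$ of the polynomials in the complex coordinate functions $z_1,z_2$. The maximal ideal space of $P(X)$ (its set of characters) is identified with $\widehat X$, a point $z\in\widehat X$ corresponding to the unique character $\varphi_z$ of $P(X)$ with $\varphi_z(p)=p(z)$ for every polynomial $p$. The Gleason parts for $P(X)$ are the equivalence classes of characters under the relation $\varphi\sim\psi$ if $\|\varphi-\psi\|<2$ in the norm of the dual space $P(X)^*$. **Theorem.** There exists a compact set $X\subset\partial B$ such that the origin lies in $\widehat X\setminus X$ and $\{0\}$ is a one-point Gleason part for $P(X)$; that is, $\varphi_0$ is the only character $\psi$ of $P(X)$ with $\|\varphi_0-\psi\|<2$. -/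

import Mathlib

noncomputable section

/-- `ℂ^N` with its Euclidean norm. -/
abbrev CSpace (N : ℕ) : Type := EuclideanSpace ℂ (Fin N)

/-- The value at `z ∈ ℂ^N` of a polynomial in the complex coordinate functions. -/
def polyEval {N : ℕ} (p : MvPolynomial (Fin N) ℂ) (z : CSpace N) : ℂ :=
  MvPolynomial.eval (fun i => z i) p

/-- The polynomial hull of a compact set `X`: the points `z` with `|p(z)| ≤ max_X |p|` for every
polynomial `p`. Since `X` is compact the maximum is attained, so the bound is expressed by a point
of `X` (and the hull of the empty set is empty). -/
def polynomialHull {N : ℕ} (X : TopologicalSpace.Compacts (CSpace N)) : Set (CSpace N) :=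
  {z | ∀ p : MvPolynomial (Fin N) ℂ, ∃ x ∈ X, ‖polyEval p z‖ ≤ ‖polyEval p x‖}

/-- The `i`-th coordinate function on `X`, as an element of `C(X)`. -/
def coordFun {N : ℕ} (X : TopologicalSpace.Compacts (CSpace N)) (i : Fin N) : C(X, ℂ) where
  toFun x := (x : CSpace N) i
  continuous_toFun := by fun_prop

/-- Restriction of polynomials to `X`, as an algebra homomorphism into `C(X)`. -/
def polyRestrict {N : ℕ} (X : TopologicalSpace.Compacts (CSpace N)) :
    MvPolynomial (Fin N) ℂ →ₐ[ℂ] C(X, ℂ) :=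
  MvPolynomial.aeval (coordFun X)

theorem polyRestrict_apply {N : ℕ} (X : TopologicalSpace.Compacts (CSpace N))
    (p : MvPolynomial (Fin N) ℂ) (x : X) : polyRestrict X p x = polyEval p x := by
  unfold polyRestrict polyEval
  induction p using MvPolynomial.induction_on with
  | C a => simp
  | add p q hp hq => simp [hp, hq]
  | mul_X p i hp => simp [hp, coordFun]

/-- `P(X)`: the uniform closure in `C(X)` of the polynomials. -/
def polyAlgebra {N : ℕ} (X : TopologicalSpace.Compacts (CSpace N)) : Subalgebra ℂ C(X, ℂ) :=
  (polyRestrict X).range.topologicalClosure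

/-- A polynomial, restricted to `X`, as an element of `P(X)`. -/
def polyElem {N : ℕ} (X : TopologicalSpace.Compacts (CSpace N)) (p : MvPolynomial (Fin N) ℂ) :
    polyAlgebra X :=
  ⟨polyRestrict X p, (polyRestrict X).range.le_topologicalClosure ⟨p, rfl⟩⟩

/-- The Gleason part of a point `φ` of the maximal ideal space (the space of characters) of a
uniform algebra `A`: all characters `ψ` with `‖φ - ψ‖ < 2` in the norm of the dual of `A`. -/
def gleasonPart {A : Type*} [NormedCommRing A] [NormedAlgebra ℂ A]
    (φ : WeakDual.characterSpace ℂ A) : Set (WeakDual.characterSpace ℂ A) :=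
  {ψ | ‖(WeakDual.CharacterSpace.toCLM φ - WeakDual.CharacterSpace.toCLM ψ : StrongDual ℂ A)‖ < 2}

/-- `φ` is the point of the maximal ideal space of `P(X)` identified with `z`, that is, the
character of `P(X)` with `φ(p) = p(z)` for every polynomial `p`. By density of the polynomials there
is at most one such character; there is one exactly when `z` lies in the polynomial hull of `X`. -/
def IsCharacterAt {N : ℕ} (X : TopologicalSpace.Compacts (CSpace N)) (z : CSpace N)
    (φ : WeakDual.characterSpace ℂ (polyAlgebra X)) : Prop :=
  ∀ p : MvPolynomial (Fin N) ℂ, φ (polyElem X p) = polyEval p z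

/-- `z` (as a point of the maximal ideal space of `P(X)`) is a one-point Gleason part for `P(X)`:
the Gleason part of the character at `z` consists of that character alone. -/
def IsOnePointGleasonPart {N : ℕ} (X : TopologicalSpace.Compacts (CSpace N)) (z : CSpace N) :
    Prop :=
  ∃ φ : WeakDual.characterSpace ℂ (polyAlgebra X),
    IsCharacterAt X z φ ∧ gleasonPart φ = {φ}

end

open Filter Topology WeakDual MvPolynomial

noncomputable section

/-! ### Real sequences -/

/-! Write `P n` for `henonPoly n`: `P 0`, `P 1` are the coordinates and `P n = P (n+1)^2 + c n * P
(n+2)` with tiny `c n`, so `P (n+1)` is nearly a square root of `P n`. Let `X` be the part of the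
unit sphere where all `|P n| ≤ 2`. The origin is in the hull because each `{P (n+1) = 0}` is an
entire curve through it. The maximum principle moves `|p(0)|` out to the sphere along the curve,
where `|P j| ≤ 2` for `j ≤ n + 1` (`exists_mem_sphere_henonPoly_eq_zero`); compactness then gives a
point of `X`. Repeated square roots drive moduli to 1. Hence the norms of `P n` on `X` have limsup
at most 1, while for a character `ψ` either all `|ψ (P n)|` are small, which forces `ψ = φ₀`, or `|ψ
(P n)|` is eventually above any number less than 1. As `P n` vanishes at 0, rescaling gives
functions in the unit ball of `P(X)` that are 0 at `φ₀` and nearly unimodular at `ψ`; by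
`two_le_norm_sub_character` the distance is at least 2. -/

/-- The Jacobians of the Hénon maps. -/
def henonCoeff (n : ℕ) : ℝ := (1 / 2) ^ n / 32

theorem henonCoeff_pos (n : ℕ) : 0 < henonCoeff n := by unfold henonCoeff; positivity

theorem henonCoeff_le (n : ℕ) : henonCoeff n ≤ 1 / 32 := by
  unfold henonCoeff
  have : ((1 : ℝ) / 2) ^ n ≤ 1 := pow_le_one₀ (by norm_num) (by norm_num)
  linarith

theorem henonCoeff_add_le (m n : ℕ) : henonCoeff (m + n) ≤ (1 / 2) ^ n / 32 := by
  have := henonCoeff_le m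
  have h : henonCoeff (m + n) = henonCoeff m * (1 / 2) ^ n := by
    unfold henonCoeff; ring
  have h2 : (0 : ℝ) < (1 / 2) ^ n := by positivity
  rw [h]; nlinarith

theorem tendsto_zero_of_le_contraction {u : ℕ → ℝ} (hu : ∀ n, 0 ≤ u n)
    (h : ∀ n, u (n + 1) ≤ 4 / 5 * (u n + (1 / 2) ^ n)) : Tendsto u atTop (𝓝 0) := by
  -- 8 is the least `C` with `4/5 * (C + 1) ≤ 9/10 * C`.
  set C := max (u 0) 8 with hC
  have key : ∀ n, u n ≤ C * (9 / 10) ^ n := by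
    intro n
    induction n with
    | zero => simp [hC]
    | succ n ih =>
      have h1 : ((1 : ℝ) / 2) ^ n ≤ (9 / 10) ^ n :=
        pow_le_pow_left₀ (by norm_num) (by norm_num) n
      have h2 : (8 : ℝ) ≤ C := le_max_right _ _
      have h3 : (0 : ℝ) < (9 / 10) ^ n := by positivity
      rw [pow_succ]
      nlinarith [h n]
  have lim : Tendsto (fun n : ℕ => C * (9 / 10 : ℝ) ^ n) atTop (𝓝 (C * 0)) :=
    (tendsto_pow_atTop_nhds_zero_of_lt_one (by norm_num) (by norm_num)).const_mul C
  rw [mul_zero] at lim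
  exact squeeze_zero hu key lim

/-- Square roots contract towards 1: above 1, `x - 1 ≤ (x ^ 2 - 1) / 2`. Applied to the norms of the
Hénon polynomials on `X`. -/
theorem eventually_le_one_add {x : ℕ → ℝ}
    (h : ∀ n, x (n + 1) ^ 2 ≤ x n + 2 * henonCoeff n) {ε : ℝ} (hε : 0 < ε) :
    ∀ᶠ n in atTop, x n ≤ 1 + ε := by
  have lim : Tendsto (fun n => max (x n - 1) 0) atTop (𝓝 0) := by
    refine tendsto_zero_of_le_contraction (fun n => le_max_right _ _) fun n => ?_
    have hl := le_max_left (x n - 1) 0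
    have hr := le_max_right (x n - 1) 0
    have hc := henonCoeff_add_le 0 n
    rw [zero_add] at hc
    have hp : (0 : ℝ) < (1 / 2) ^ n := by positivity
    apply max_le
    · by_cases h1 : x (n + 1) ≤ 1
      · linarith
      · nlinarith [h n]
    · linarith
  filter_upwards [lim.eventually (gt_mem_nhds hε)] with n hn
  have := le_max_left (x n - 1) 0
  linarith

theorem eventually_one_sub_le {x : ℕ → ℝ} (h0 : ∀ n, 0 ≤ x n)
    (h : ∀ n, x n ≤ x (n + 1) ^ 2 + 2 * henonCoeff n) {m : ℕ} (hm : 1 / 8 ≤ x m)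
    {ε : ℝ} (hε : 0 < ε) : ∀ᶠ n in atTop, 1 - ε ≤ x n := by
  have low : ∀ n, 1 / 4 ≤ x (m + n + 1) := by
    -- Since `2 * henonCoeff k ≤ 1/16`, the next square is at least `1/16`.
    have step : ∀ k, 1 / 8 ≤ x k → 1 / 4 ≤ x (k + 1) := by
      intro k hk
      have h1 := h k
      have h2 := henonCoeff_le k
      have h3 := h0 (k + 1)
      by_contra! h4
      nlinarith
    intro n
    induction n with
    | zero => exact step _ hm
    | succ n ih => exact step _ (by rw [← add_assoc]; linarith)
  have lim : Tendsto (fun n => max (1 - x (m + n)) 0) atTop (𝓝 0) := by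
    refine tendsto_zero_of_le_contraction (fun n => le_max_right _ _) fun n => ?_
    have hl := le_max_left (1 - x (m + n)) 0
    have hr := le_max_right (1 - x (m + n)) 0
    have hc := henonCoeff_add_le m n
    have hp : (0 : ℝ) < (1 / 2) ^ n := by positivity
    -- The rate `4/5` comes from `1 - x = (1 - x ^ 2) / (1 + x)` with `1 + x ≥ 5/4`.
    have hlow := low n
    have hh := h (m + n)
    rw [← add_assoc]
    apply max_le
    · by_cases h1 : 1 ≤ x (m + n + 1)
      · linarith
      · nlinarith
    · linarith
  have lim' : Tendsto (fun n => max (1 - x n) 0) atTop (𝓝 0) := by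
    rw [← tendsto_add_atTop_iff_nat m]
    simpa only [add_comm m] using lim
  filter_upwards [lim'.eventually (gt_mem_nhds hε)] with n hn
  have := le_max_left (1 - x n) 0
  linarith

/-- A point with a small bounded orbit is the fixed point. -/
theorem eq_zero_of_small_orbit {x : ℕ → ℝ} (h0 : ∀ n, 0 ≤ x n)
    (h : ∀ n, x n ≤ x (n + 1) ^ 2 + henonCoeff n * x (n + 2)) (hx : ∀ n, x n ≤ 1 / 8) (n : ℕ) :
    x n = 0 := by
  -- Bounding one factor of the square by `1/8`, each pass gains `1/8 + 1/32 < 1/2`.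
  have key : ∀ k : ℕ, ∀ n, x n ≤ (1 / 2) ^ k := by
    intro k
    induction k with
    | zero => intro n; have := hx n; norm_num; linarith
    | succ k ih =>
      intro n
      have h1 := ih (n + 1)
      have h2 := ih (n + 2)
      have h3 := hx (n + 1)
      have h4 := henonCoeff_le n
      have h5 := henonCoeff_pos n
      have h6 := h n
      have h7 := h0 (n + 1)
      have h8 := h0 (n + 2)
      have hp : (0 : ℝ) < (1 / 2) ^ k := by positivity
      rw [pow_succ]
      nlinarith
  refine le_antisymm ?_ (h0 n)
  exact ge_of_tendsto' (tendsto_pow_atTop_nhds_zero_of_lt_one (by norm_num : (0 : ℝ) ≤ 1 / 2)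
    (by norm_num)) fun k => key k n

/-- A discrete maximum principle along a finite orbit. -/
theorem le_two_of_finite_orbit {x : ℕ → ℝ} {n : ℕ} (hfirst : x 0 ≤ 1)
    (hlast : x (n + 1) = 0) (h : ∀ j < n, x (j + 1) ^ 2 ≤ x j + x (j + 2)) :
    ∀ j ≤ n + 1, x j ≤ 2 := by
  obtain ⟨k, hk, hmax⟩ := Finset.exists_max_image (Finset.range (n + 2)) x ⟨0, by simp⟩
  -- At an interior maximum `M` the recursion gives `M ^ 2 ≤ 2 * M`.
  have hk2 : x k ≤ 2 := by
    rcases k with _ | k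
    · linarith
    · rw [Finset.mem_range] at hk
      rcases eq_or_lt_of_le (show k ≤ n by omega) with rfl | hkn
      · rw [hlast]; norm_num
      · have h1 := hmax k (by simp; omega)
        have h2 := hmax (k + 2) (by simp; omega)
        have h3 := h k hkn
        by_contra! h4
        nlinarith
  exact fun j hj => (hmax j (by simp; omega)).trans hk2

/-! ### The iterated Hénon polynomials -/

/-- The coordinate functions of the compositions of the Hénon maps
`(a, b) ↦ (b, (a - b ^ 2) / cₙ)`. -/
def henonPoly : ℕ → MvPolynomial (Fin 2) ℂ
  | 0 => X 0
  | 1 => X 1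
  | n + 2 => C ((henonCoeff n : ℂ)⁻¹) * (henonPoly n - henonPoly (n + 1) ^ 2)

theorem henonPoly_eq (n : ℕ) :
    henonPoly n = henonPoly (n + 1) ^ 2 + C (henonCoeff n : ℂ) * henonPoly (n + 2) := by
  have h : (henonCoeff n : ℂ) ≠ 0 := by exact_mod_cast (henonCoeff_pos n).ne'
  rw [show henonPoly (n + 2) =
    C ((henonCoeff n : ℂ)⁻¹) * (henonPoly n - henonPoly (n + 1) ^ 2) from rfl,
    ← mul_assoc, ← C_mul, mul_inv_cancel₀ h, C_1]
  ring

theorem norm_henonCoeff (n : ℕ) : ‖(henonCoeff n : ℂ)‖ = henonCoeff n := by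
  rw [Complex.norm_real, Real.norm_of_nonneg (henonCoeff_pos n).le]

section Orbit

variable (g : MvPolynomial (Fin 2) ℂ →ₐ[ℂ] ℂ)

theorem algHom_henonPoly (n : ℕ) :
    g (henonPoly n) = g (henonPoly (n + 1)) ^ 2 + henonCoeff n * g (henonPoly (n + 2)) := by
  conv_lhs => rw [henonPoly_eq n]
  rw [map_add, map_pow, map_mul, algHom_C]
  rfl

theorem norm_henonPoly_le (n : ℕ) :
    ‖g (henonPoly n)‖ ≤
      ‖g (henonPoly (n + 1))‖ ^ 2 + henonCoeff n * ‖g (henonPoly (n + 2))‖ := by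
  rw [algHom_henonPoly g n]
  refine (norm_add_le _ _).trans_eq ?_
  rw [norm_pow, norm_mul, norm_henonCoeff]

theorem norm_henonPoly_sq_le (n : ℕ) :
    ‖g (henonPoly (n + 1))‖ ^ 2 ≤
      ‖g (henonPoly n)‖ + henonCoeff n * ‖g (henonPoly (n + 2))‖ := by
  rw [← norm_pow, show g (henonPoly (n + 1)) ^ 2 =
    g (henonPoly n) - henonCoeff n * g (henonPoly (n + 2)) by rw [algHom_henonPoly g n]; ring]
  refine (norm_sub_le _ _).trans_eq ?_
  rw [norm_mul, norm_henonCoeff]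

end Orbit

/-- Evaluation of polynomials at a point, as an algebra homomorphism. -/
def polyEvalHom {N : ℕ} (z : CSpace N) : MvPolynomial (Fin N) ℂ →ₐ[ℂ] ℂ :=
  MvPolynomial.aeval (fun i => z i)

theorem polyEvalHom_apply {N : ℕ} (z : CSpace N) (p : MvPolynomial (Fin N) ℂ) :
    polyEvalHom z p = polyEval p z := by
  rw [polyEvalHom, polyEval, MvPolynomial.aeval_eq_eval]

theorem continuous_polyEval {N : ℕ} (p : MvPolynomial (Fin N) ℂ) :
    Continuous (polyEval p) := by
  unfold polyEval
  exact (MvPolynomial.continuous_eval p).comp (by fun_prop)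

theorem differentiable_polyEval {N : ℕ} (p : MvPolynomial (Fin N) ℂ) :
    Differentiable ℂ (polyEval p) := by
  unfold polyEval
  induction p using MvPolynomial.induction_on with
  | C a => simp
  | add p q hp hq =>
    simp only [map_add]
    exact hp.add hq
  | mul_X p i hp =>
    simp only [map_mul, eval_X]
    exact hp.mul (by fun_prop)

theorem polyEval_henonPoly_zero (n : ℕ) : polyEval (henonPoly n) 0 = 0 := by
  induction n using Nat.twoStepInduction with
  | zero => simp [polyEval, henonPoly]
  | one => simp [polyEval, henonPoly]
  | more n h1 h2 =>
    unfold polyEval at h1 h2 ⊢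
    rw [henonPoly, map_mul, map_sub, map_pow, h1, h2]
    ring

/-! ### Inverse Hénon maps and the analytic curves through the origin -/

/-- The inverse of the `n`-fold composition of Hénon maps, with its components. -/
def henonInv : ℕ → ℂ × ℂ → ℂ × ℂ
  | 0, q => q
  | n + 1, q => henonInv n (q.1 ^ 2 + henonCoeff n * q.2, q.1)

theorem differentiable_henonInv (n : ℕ) : Differentiable ℂ (henonInv n) := by
  induction n with
  | zero => exact differentiable_id
  | succ n ih =>
    exact ih.comp (by fun_prop : Differentiable ℂ
      fun q : ℂ × ℂ => (q.1 ^ 2 + (henonCoeff n : ℂ) * q.2, q.1))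

theorem henonInv_zero (n : ℕ) : henonInv n 0 = 0 := by
  induction n with
  | zero => rfl
  | succ n ih =>
    have h : ((0 : ℂ) ^ 2 + henonCoeff n * 0, (0 : ℂ)) = 0 := by ext <;> simp
    exact (congrArg (henonInv n) h).trans ih

theorem polyEval_henonInv (n : ℕ) (q : ℂ × ℂ) :
    polyEval (henonPoly n) !₂[(henonInv n q).1, (henonInv n q).2] = q.1 ∧
    polyEval (henonPoly (n + 1)) !₂[(henonInv n q).1, (henonInv n q).2] = q.2 := by
  induction n generalizing q with
  | zero => simp [polyEval, henonPoly, henonInv]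
  | succ n ih =>
    have h : (henonCoeff n : ℂ) ≠ 0 := by exact_mod_cast (henonCoeff_pos n).ne'
    obtain ⟨h1, h2⟩ := ih (q.1 ^ 2 + henonCoeff n * q.2, q.1)
    refine ⟨h2, ?_⟩
    have h3 := algHom_henonPoly
      (polyEvalHom !₂[(henonInv (n + 1) q).1, (henonInv (n + 1) q).2]) n
    simp only [polyEvalHom_apply] at h3
    change polyEval (henonPoly n) !₂[(henonInv (n + 1) q).1, (henonInv (n + 1) q).2] = _ at h1
    change polyEval (henonPoly (n + 1)) !₂[(henonInv (n + 1) q).1, (henonInv (n + 1) q).2] = _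
      at h2
    rw [h1, h2] at h3
    exact (mul_left_cancel₀ h (add_left_cancel h3)).symm

/-- The entire curve `{henonPoly (n + 1) = 0}`, parametrized by `henonPoly n`. -/
def henonCurve (n : ℕ) (t : ℂ) : CSpace 2 := !₂[(henonInv n (t, 0)).1, (henonInv n (t, 0)).2]

theorem differentiable_henonCurve (n : ℕ) : Differentiable ℂ (henonCurve n) := by
  have h : Differentiable ℂ fun t : ℂ => henonInv n (t, 0) :=
    (differentiable_henonInv n).comp (by fun_prop)
  rw [differentiable_euclidean]
  intro i
  fin_cases i
  · simpa [henonCurve] using h.fst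
  · simpa [henonCurve] using h.snd

theorem henonCurve_zero (n : ℕ) : henonCurve n 0 = 0 := by
  have : henonInv n (0, 0) = 0 := henonInv_zero n
  ext i
  fin_cases i <;> simp [henonCurve, this]

/-- The orbit segment starts in the unit disc and ends at 0, so the discrete maximum principle
applies. This both bounds the curve's parameter and puts its points near the defining conditions of
`henonCompact`. -/
theorem norm_henonPoly_le_two_of_eq_zero {n : ℕ} {z : CSpace 2} (hz : ‖z‖ ≤ 1)
    (hn : polyEval (henonPoly (n + 1)) z = 0) :
    ∀ j ≤ n + 1, ‖polyEval (henonPoly j) z‖ ≤ 2 := by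
  refine le_two_of_finite_orbit (x := fun j => ‖polyEval (henonPoly j) z‖) ?_ (by simp [hn]) ?_
  · simpa [polyEval, henonPoly] using (PiLp.norm_apply_le z 0).trans hz
  · intro j _
    have h := norm_henonPoly_sq_le (polyEvalHom z) j
    simp only [polyEvalHom_apply] at h
    have h1 := henonCoeff_le j
    have h2 := norm_nonneg (polyEval (henonPoly (j + 2)) z)
    nlinarith

/-- The maximum principle on the curve `{henonPoly (n + 1) = 0}` in the unit ball. -/
theorem exists_mem_sphere_henonPoly_eq_zero (n : ℕ) (p : MvPolynomial (Fin 2) ℂ) :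
    ∃ z : CSpace 2, ‖z‖ = 1 ∧ polyEval (henonPoly (n + 1)) z = 0 ∧
      ‖polyEval p 0‖ ≤ ‖polyEval p z‖ := by
  set U : Set ℂ := {t | ‖henonCurve n t‖ < 1} with hU
  have hd := differentiable_henonCurve n
  have hzero : ∀ t, polyEval (henonPoly (n + 1)) (henonCurve n t) = 0 := fun t =>
    (polyEval_henonInv n (t, 0)).2
  have h0 : (0 : ℂ) ∈ U := by simp [hU, henonCurve_zero]
  -- On the curve the parameter `t` is the value of `henonPoly n`, hence at most 2 in modulus inside
  -- the ball.
  have hb : Bornology.IsBounded U := by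
    refine (Metric.isBounded_closedBall (x := (0 : ℂ)) (r := 2)).subset fun t ht => ?_
    have h := norm_henonPoly_le_two_of_eq_zero (le_of_lt ht) (hzero t) n (by omega)
    rw [show polyEval (henonPoly n) (henonCurve n t) = t from
      (polyEval_henonInv n (t, 0)).1] at h
    simpa using h
  obtain ⟨t, ht, hmax⟩ := Complex.exists_mem_frontier_isMaxOn_norm
    (f := fun t => polyEval p (henonCurve n t)) hb ⟨0, h0⟩
    ((differentiable_polyEval p).comp hd).diffContOnCl
  refine ⟨henonCurve n t, ?_, hzero t, ?_⟩
  · exact frontier_lt_subset_eq hd.continuous.norm continuous_const ht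
  · have := hmax (subset_closure h0)
    simpa [henonCurve_zero] using this

/-! ### The compact set -/

/-- The points of the unit sphere with bounded orbit under the Hénon maps. -/
def henonCompact : TopologicalSpace.Compacts (CSpace 2) where
  carrier := Metric.sphere 0 1 ∩ ⋂ n, {z | ‖polyEval (henonPoly n) z‖ ≤ 2}
  isCompact' := (isCompact_sphere _ _).inter_right <| isClosed_iInter fun _ =>
    isClosed_le (continuous_polyEval _).norm continuous_const

theorem mem_henonCompact {z : CSpace 2} :
    z ∈ henonCompact ↔ ‖z‖ = 1 ∧ ∀ n, ‖polyEval (henonPoly n) z‖ ≤ 2 := by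
  change z ∈ Metric.sphere 0 1 ∩ ⋂ n, {z | ‖polyEval (henonPoly n) z‖ ≤ 2} ↔ _
  simp

/-- For fixed `p`, imposing only the first bounds gives decreasing compact sets, nonempty by the
curves; a common point lies in `henonCompact`. -/
theorem zero_mem_polynomialHull_henonCompact : (0 : CSpace 2) ∈ polynomialHull henonCompact := by
  intro p
  let S : ℕ → Set (CSpace 2) := fun n => Metric.sphere 0 1 ∩
    ({z | ‖polyEval p 0‖ ≤ ‖polyEval p z‖} ∩ ⋂ j ≤ n, {z | ‖polyEval (henonPoly j) z‖ ≤ 2})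
  have hclosed : ∀ n, IsClosed
      ({z | ‖polyEval p 0‖ ≤ ‖polyEval p z‖} ∩
        ⋂ j ≤ n, {z | ‖polyEval (henonPoly j) z‖ ≤ 2}) := fun _ =>
    (isClosed_le continuous_const (continuous_polyEval _).norm).inter <|
      isClosed_iInter fun j => isClosed_iInter fun _ =>
        isClosed_le (continuous_polyEval _).norm continuous_const
  have hcompact : ∀ n, IsCompact (S n) := fun n => (isCompact_sphere _ _).inter_right (hclosed n)
  have hne : ∀ n, (S n).Nonempty := fun n => by
    obtain ⟨z, hz, hz0, hp⟩ := exists_mem_sphere_henonPoly_eq_zero n p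
    refine ⟨z, by simpa using hz, hp, ?_⟩
    simp only [Set.mem_iInter]
    exact fun j hj => norm_henonPoly_le_two_of_eq_zero hz.le hz0 j (by omega)
  obtain ⟨z, hz⟩ := IsCompact.nonempty_iInter_of_sequence_nonempty_isCompact_isClosed S
    (fun _ z hz => ⟨hz.1, hz.2.1, by
      have := hz.2.2
      simp only [Set.mem_iInter] at this ⊢
      exact fun j hj => this j (by omega)⟩) hne (hcompact 0) fun n => (hcompact n).isClosed
  rw [Set.mem_iInter] at hz
  refine ⟨z, mem_henonCompact.2 ⟨by simpa using (hz 0).1, fun n => ?_⟩, (hz 0).2.1⟩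
  have := (hz n).2.2
  simp only [Set.mem_iInter] at this
  exact this n le_rfl

/-! ### Characters of `P(X)` -/

section Characters

variable {N : ℕ} (K : TopologicalSpace.Compacts (CSpace N))

/-- `polyElem` as an algebra homomorphism. -/
def polyElemHom : MvPolynomial (Fin N) ℂ →ₐ[ℂ] polyAlgebra K :=
  (polyRestrict K).codRestrict (polyAlgebra K) fun p => (polyElem K p).2

theorem polyElemHom_apply (p : MvPolynomial (Fin N) ℂ) : polyElemHom K p = polyElem K p := rfl

theorem norm_polyElem_le {p : MvPolynomial (Fin N) ℂ} {M : ℝ} (hM : 0 ≤ M)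
    (h : ∀ x ∈ K, ‖polyEval p x‖ ≤ M) : ‖polyElem K p‖ ≤ M := by
  change ‖polyRestrict K p‖ ≤ M
  rw [ContinuousMap.norm_le _ hM]
  intro x
  rw [polyRestrict_apply]
  exact h x x.2

theorem norm_polyEval_le {p : MvPolynomial (Fin N) ℂ} {x : CSpace N} (hx : x ∈ K) :
    ‖polyEval p x‖ ≤ ‖polyElem K p‖ := by
  have := ContinuousMap.norm_coe_le_norm (polyRestrict K p) ⟨x, hx⟩
  rwa [polyRestrict_apply] at this

theorem denseRange_polyElem : DenseRange (polyElem K) := by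
  intro a
  rw [closure_subtype]
  have h : ((↑) : polyAlgebra K → C(K, ℂ)) '' Set.range (polyElem K) =
      ((polyRestrict K).range : Set C(K, ℂ)) := by
    ext f; simp [polyElem]
  rw [h]
  exact a.2

instance : CompleteSpace (polyAlgebra K) :=
  (Subalgebra.isClosed_topologicalClosure _).completeSpace_coe

variable {K}

theorem characterSpace_ext {φ ψ : characterSpace ℂ (polyAlgebra K)}
    (h : ∀ p, φ (polyElem K p) = ψ (polyElem K p)) : φ = ψ := by
  have : (φ : polyAlgebra K → ℂ) = ψ :=
    (denseRange_polyElem K).equalizer (map_continuous φ) (map_continuous ψ) (funext h)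
  exact DFunLike.coe_injective this

theorem character_polyElem (φ : characterSpace ℂ (polyAlgebra K))
    (p : MvPolynomial (Fin N) ℂ) :
    φ (polyElem K p) = eval (fun i => φ (polyElem K (X i))) p := by
  have : (CharacterSpace.toAlgHom φ).comp (polyElemHom K) =
      aeval (fun i => φ (polyElem K (X i))) := by
    ext i
    simp [polyElemHom_apply]
  have h := DFunLike.congr_fun this p
  rw [aeval_eq_eval] at h
  exact h

/-- The coordinates generate a proper ideal: for polynomials `p i`, `1 - ∑ i, p i * X i` is 1 at the
origin, so has norm at least 1, and by density 1 is not in the ideal. A maximal ideal above it gives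
the character. -/
theorem exists_isCharacterAt_zero (h : (0 : CSpace N) ∈ polynomialHull K) :
    ∃ φ : characterSpace ℂ (polyAlgebra K), IsCharacterAt K 0 φ := by
  have key : ∀ (p : MvPolynomial (Fin N) ℂ), ‖polyEval p 0‖ ≤ ‖polyElem K p‖ := fun p => by
    obtain ⟨x, hx, hp⟩ := h p
    exact hp.trans (norm_polyEval_le K hx)
  set I : Ideal (polyAlgebra K) := Ideal.span (Set.range fun i => polyElem K (X i)) with hI
  have hne : I ≠ ⊤ := by
    rw [Ideal.ne_top_iff_one, hI, Ideal.mem_span_range_iff_exists_fun]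
    rintro ⟨c, hc⟩
    have dense : DenseRange fun (p : Fin N → MvPolynomial (Fin N) ℂ) i => polyElem K (p i) :=
      DenseRange.piMap fun _ => denseRange_polyElem K
    have hcl : IsClosed {c : Fin N → polyAlgebra K |
        1 ≤ ‖1 - ∑ i, c i * polyElem K (X i)‖} := by
      refine isClosed_le continuous_const ?_
      fun_prop
    have h1 : 1 ≤ ‖1 - ∑ i, c i * polyElem K (X i)‖ := by
      refine dense.induction_on (p := fun c => 1 ≤ ‖1 - ∑ i, c i * polyElem K (X i)‖) c hcl ?_
      intro p
      have h2 := key (1 - ∑ i, p i * X i)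
      have h3 : polyEval (1 - ∑ i, p i * X i) (0 : CSpace N) = 1 := by simp [polyEval]
      have h4 : polyElem K (1 - ∑ i, p i * X i) =
          1 - ∑ i, polyElem K (p i) * polyElem K (X i) := by
        simp_rw [← polyElemHom_apply, map_sub, map_one, map_sum, map_mul]
      rwa [h3, h4, norm_one] at h2
    rw [hc, sub_self, norm_zero] at h1
    linarith
  obtain ⟨M, hM, hIM⟩ := I.exists_le_maximal hne
  refine ⟨M.toCharacterSpace, fun p => ?_⟩
  have h0 : ∀ i, M.toCharacterSpace (polyElem K (X i)) = 0 := fun i =>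
    M.toCharacterSpace_apply_eq_zero_of_mem (hIM (Ideal.subset_span ⟨i, rfl⟩))
  rw [character_polyElem]
  simp [h0, polyEval]

end Characters

/-! ### The norm of a difference of characters -/

/-- The squared difference is `(1 - r ^ 2) * (1 - |w| ^ 2)`. -/
theorem norm_sub_le_norm_one_sub {r : ℝ} (hr0 : 0 ≤ r) (hr1 : r < 1) {w : ℂ} (hw : ‖w‖ ≤ 1) :
    ‖(r : ℂ) - w‖ ≤ ‖1 - (r : ℂ) * w‖ := by
  refine le_of_sq_le_sq ?_ (norm_nonneg _)
  have h : w.re ^ 2 + w.im ^ 2 ≤ 1 := by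
    have := Complex.sq_norm w
    rw [Complex.normSq_apply] at this
    nlinarith [norm_nonneg w]
  rw [Complex.sq_norm, Complex.sq_norm, Complex.normSq_apply, Complex.normSq_apply]
  simp
  nlinarith [mul_nonneg (sub_nonneg.2 h) (show 0 ≤ 1 - r ^ 2 by nlinarith)]

section UniformAlgebra

variable {Y : Type*} [TopologicalSpace Y] [CompactSpace Y] {A : Subalgebra ℂ C(Y, ℂ)}
  [CompleteSpace A]

/-- The Möbius transformation `(r - g) / (1 - r g)` in a uniform algebra. -/
theorem exists_moebius {g : A} (hg : ‖g‖ ≤ 1) {r : ℝ} (hr0 : 0 ≤ r) (hr1 : r < 1) :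
    ∃ h : A, ‖h‖ ≤ 1 ∧ h * (1 - (r : ℂ) • g) = (r : ℂ) • 1 - g := by
  have hlt : ‖(r : ℂ) • g‖ < 1 := by
    rw [norm_smul, Complex.norm_real, Real.norm_of_nonneg hr0]
    nlinarith [norm_nonneg g]
  obtain ⟨u, hu⟩ := isUnit_one_sub_of_norm_lt_one hlt
  have hmul : ((r : ℂ) • 1 - g) * (↑u⁻¹ : A) * (1 - (r : ℂ) • g) = (r : ℂ) • 1 - g := by
    rw [← hu, mul_assoc, Units.inv_mul, mul_one]
  refine ⟨((r : ℂ) • 1 - g) * (↑u⁻¹ : A), ?_, hmul⟩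
  generalize ((r : ℂ) • 1 - g) * (↑u⁻¹ : A) = h at hmul
  change ‖(h : C(Y, ℂ))‖ ≤ 1
  rw [ContinuousMap.norm_le _ zero_le_one]
  intro y
  have hgy : ‖(g : C(Y, ℂ)) y‖ ≤ 1 := (ContinuousMap.norm_coe_le_norm _ y).trans hg
  have hy : (h : C(Y, ℂ)) y * (1 - r * (g : C(Y, ℂ)) y) = r - (g : C(Y, ℂ)) y := by
    have := congrArg (fun a : A => (a : C(Y, ℂ)) y) hmul
    simpa using this
  have hpos : 0 < ‖1 - (r : ℂ) * (g : C(Y, ℂ)) y‖ := by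
    have h1 : ‖(r : ℂ) * (g : C(Y, ℂ)) y‖ < 1 := by
      rw [norm_mul, Complex.norm_real, Real.norm_of_nonneg hr0]
      nlinarith [norm_nonneg ((g : C(Y, ℂ)) y)]
    have h2 := norm_sub_norm_le (1 : ℂ) ((r : ℂ) * (g : C(Y, ℂ)) y)
    rw [norm_one] at h2
    linarith
  have h3 := norm_sub_le_norm_one_sub hr0 hr1 hgy
  rw [← hy, norm_mul] at h3
  exact le_of_mul_le_mul_right (by linarith) hpos

theorem norm_character_le (ψ : characterSpace ℂ A) (a : A) : ‖ψ a‖ ≤ ‖a‖ := by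
  have h1 : ‖ψ a‖ ≤ ‖a‖ * ‖(1 : A)‖ := spectrum.norm_le_norm_mul_of_mem
    (AlgHom.apply_mem_spectrum (CharacterSpace.toAlgHom ψ) a)
  have h2 : ‖(1 : A)‖ ≤ 1 := by
    change ‖(1 : C(Y, ℂ))‖ ≤ 1
    exact (ContinuousMap.norm_le _ zero_le_one).2 fun y => by simp
  nlinarith [norm_nonneg a]

/-- A disc automorphism applied to `g` moves the values 0 and nearly 1 to `r` and at most `-r`, and
`r` may tend to 1. -/
theorem two_le_norm_sub_character {φ ψ : characterSpace ℂ A}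
    (h : ∀ ε > 0, ∃ g : A, ‖g‖ ≤ 1 ∧ φ g = 0 ∧ 1 - ε ≤ ‖ψ g‖) :
    2 ≤ ‖(CharacterSpace.toCLM φ - CharacterSpace.toCLM ψ : StrongDual ℂ A)‖ := by
  have key : ∀ r : ℝ, 0 ≤ r → r < 1 →
      2 * r ≤ ‖(CharacterSpace.toCLM φ - CharacterSpace.toCLM ψ : StrongDual ℂ A)‖ := by
    intro r hr0 hr1
    -- `(r - a) / (1 - r * a) ≤ -r` means `a ≥ 2 * r / (1 + r ^ 2) = 1 - (1 - r) ^ 2 / (1 + r ^ 2)`,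
    -- and `1 + r ^ 2 ≤ 2`.
    obtain ⟨g, hg, hφ, hψ⟩ := h ((1 - r) ^ 2 / 2) (by have := sub_pos.2 hr1; positivity)
    obtain ⟨c, hc, hcg⟩ : ∃ c : ℂ, ‖c‖ ≤ 1 ∧ c * ψ g = (‖ψ g‖ : ℂ) := by
      by_cases h0 : ψ g = 0
      · exact ⟨0, by simp, by simp [h0]⟩
      · have h0' : (‖ψ g‖ : ℂ) ≠ 0 := by exact_mod_cast norm_ne_zero_iff.2 h0
        refine ⟨(starRingEnd ℂ) (ψ g) / ‖ψ g‖, ?_, ?_⟩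
        · simp [norm_ne_zero_iff.2 h0]
        · rw [div_mul_eq_mul_div, Complex.conj_mul', div_eq_iff h0']; ring
    have hcg1 : ‖c • g‖ ≤ 1 := by
      rw [norm_smul]; nlinarith [norm_nonneg c, norm_nonneg g]
    obtain ⟨f, hf, hfg⟩ := exists_moebius hcg1 hr0 hr1
    have eval_moebius : ∀ χ : characterSpace ℂ A,
        χ f * (1 - r * (c * χ g)) = r - c * χ g := by
      intro χ
      have := congrArg χ hfg
      rwa [map_mul, map_sub, map_sub, map_smul, map_smul, map_smul, map_one,
        smul_eq_mul, smul_eq_mul, smul_eq_mul, mul_one] at this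
    have hφf : φ f = r := by simpa [hφ] using eval_moebius φ
    have hψf : ψ f * (1 - r * ‖ψ g‖) = r - ‖ψ g‖ := by simpa only [hcg] using eval_moebius ψ
    set a : ℝ := ‖ψ g‖ with ha
    have hden : r * a < 1 := by
      have : a ≤ 1 := (norm_character_le ψ g).trans hg
      nlinarith [norm_nonneg (ψ g)]
    have hψf' : ψ f = ((r - a) / (1 - r * a) : ℝ) := by
      have : (1 - r * a : ℂ) ≠ 0 := by
        exact_mod_cast (sub_pos.2 hden).ne'
      push_cast
      rw [eq_div_iff this]
      exact hψf
    have h1 : ‖φ f - ψ f‖ ≤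
        ‖(CharacterSpace.toCLM φ - CharacterSpace.toCLM ψ : StrongDual ℂ A)‖ := by
      refine ((CharacterSpace.toCLM φ - CharacterSpace.toCLM ψ : StrongDual ℂ A).le_opNorm
        f).trans ?_
      exact mul_le_of_le_one_right (norm_nonneg _) hf
    rw [hφf, hψf', ← Complex.ofReal_sub, Complex.norm_real] at h1
    refine le_trans ?_ ((le_abs_self _).trans h1)
    have h2 : (r - a) / (1 - r * a) ≤ -r := by
      rw [div_le_iff₀ (by linarith)]
      nlinarith
    linarith
  by_contra! hlt
  set B := ‖(CharacterSpace.toCLM φ - CharacterSpace.toCLM ψ : StrongDual ℂ A)‖ with hB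
  have hB0 := key 0 le_rfl one_pos
  -- This `r` makes `2 * r` the midpoint of `B` and 2, so it exceeds `B`.
  have := key ((B + 2) / 4) (by linarith) (by linarith)
  linarith

end UniformAlgebra

/-! ### The Gleason part of the origin -/

theorem norm_polyElem_henonPoly_sq_le (n : ℕ) :
    ‖polyElem henonCompact (henonPoly (n + 1))‖ ^ 2 ≤
      ‖polyElem henonCompact (henonPoly n)‖ + 2 * henonCoeff n := by
  have hpos : 0 ≤ ‖polyElem henonCompact (henonPoly n)‖ + 2 * henonCoeff n :=
    add_nonneg (norm_nonneg _) (mul_nonneg zero_le_two (henonCoeff_pos n).le)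
  rw [← Real.le_sqrt (norm_nonneg _) hpos]
  refine norm_polyElem_le _ (Real.sqrt_nonneg _) fun x hx => ?_
  rw [Real.le_sqrt (norm_nonneg _) hpos]
  have h := norm_henonPoly_sq_le (polyEvalHom x) n
  simp only [polyEvalHom_apply] at h
  have h1 := norm_polyEval_le henonCompact (p := henonPoly n) hx
  have h2 := (mem_henonCompact.1 hx).2 (n + 2)
  nlinarith [henonCoeff_pos n]

theorem gleasonPart_henonCompact_zero {φ : characterSpace ℂ (polyAlgebra henonCompact)}
    (hφ : IsCharacterAt henonCompact 0 φ) : gleasonPart φ = {φ} := by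
  refine Set.Subset.antisymm (fun ψ hψ => ?_) ?_
  swap
  · rintro _ rfl
    simp [gleasonPart]
  by_contra hne
  refine (not_le.2 hψ) (two_le_norm_sub_character fun ε hε => ?_)
  let g : MvPolynomial (Fin 2) ℂ →ₐ[ℂ] ℂ :=
    (CharacterSpace.toAlgHom ψ).comp (polyElemHom henonCompact)
  have hgle : ∀ p, ‖g p‖ ≤ ‖polyElem henonCompact p‖ := fun p => norm_character_le ψ _
  have hg2 : ∀ n, ‖g (henonPoly n)‖ ≤ 2 := fun n =>
    (hgle _).trans (norm_polyElem_le _ zero_le_two fun x hx => (mem_henonCompact.1 hx).2 n)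
  -- Otherwise the whole orbit is zero; its first two terms are the values of `ψ` on the
  -- coordinates, so `ψ` would be `φ`.
  obtain ⟨m, hm⟩ : ∃ m, 1 / 8 ≤ ‖g (henonPoly m)‖ := by
    by_contra! hsmall
    have h0 := eq_zero_of_small_orbit (fun n => norm_nonneg (g (henonPoly n)))
      (norm_henonPoly_le g) fun n => (hsmall n).le
    refine hne (characterSpace_ext fun p => ?_)
    rw [hφ p, character_polyElem ψ p, polyEval]
    congr 2
    ext i
    fin_cases i
    · exact norm_eq_zero.1 (h0 0)
    · exact norm_eq_zero.1 (h0 1)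
  have hlow := eventually_one_sub_le (fun n => norm_nonneg (g (henonPoly n)))
    (fun n => by
      have h1 := norm_henonPoly_le g n
      have h2 := hg2 (n + 2)
      nlinarith [henonCoeff_pos n]) hm (half_pos hε)
  have hupp := eventually_le_one_add
    (x := fun n => ‖polyElem henonCompact (henonPoly n)‖) norm_polyElem_henonPoly_sq_le (half_pos hε)
  obtain ⟨n, hn1, hn2⟩ := (hlow.and hupp).exists
  have hpos : (0 : ℝ) < 1 + ε / 2 := by positivity
  -- Rescaling into the unit ball costs little: `(1 - ε) * (1 + ε / 2) ≤ 1 - ε / 2`.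
  refine ⟨(((1 + ε / 2)⁻¹ : ℝ) : ℂ) • polyElem henonCompact (henonPoly n), ?_, ?_, ?_⟩
  · rw [norm_smul, Complex.norm_real, Real.norm_of_nonneg (inv_pos.2 hpos).le,
      inv_mul_le_iff₀ hpos, mul_one]
    exact hn2
  · rw [map_smul, hφ, polyEval_henonPoly_zero, smul_zero]
  · rw [map_smul, norm_smul, Complex.norm_real, Real.norm_of_nonneg (inv_pos.2 hpos).le,
      ← div_eq_inv_mul, le_div_iff₀ hpos]
    have : 1 - ε / 2 ≤ ‖ψ (polyElem henonCompact (henonPoly n))‖ := hn1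
    nlinarith

end

theorem theorem1p1 :
    ∃ X : TopologicalSpace.Compacts (CSpace 2),
      (X : Set (CSpace 2)) ⊆ frontier (Metric.ball (0 : CSpace 2) 1) ∧
      (0 : CSpace 2) ∈ polynomialHull X \ (X : Set (CSpace 2)) ∧
      IsOnePointGleasonPart X 0 := by
  refine ⟨henonCompact, ?_, ⟨zero_mem_polynomialHull_henonCompact, ?_⟩, ?_⟩
  · rw [frontier_ball _ one_ne_zero]
    exact fun z hz => by simpa using (mem_henonCompact.1 hz).1
  · intro h
    have := (mem_henonCompact.1 h).1
    simp at this
  · obtain ⟨φ, hφ⟩ := exists_isCharacterAt_zero zero_mem_polynomialHull_henonCompact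
    exact ⟨φ, hφ, gleasonPart_henonCompact_zero hφ⟩
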